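/- Let $k$ be a field. All algebras are $k$-algebras, homomorphisms and automorphisms are $k$-linear, $\otimes=\otimes_k$, modules are left modules, and $A^{e}=A\otimes A^{\circ}$ is the enveloping algebra of an algebra $A$, so that $A$ is an $A^e$-module and $A$-bimodules are $A^e$-modules. Dimensions take values in $\{-\infty\}\cup\mathbb N\cup\{\infty\}$, and for a ring $R$, $\operatorname{injdim}R$ is the injective dimension of $R$ as a module over itself. "Noetherian" means left and right noetherian. Put $$\operatorname{Htr}A=\operatorname{injdim}A^e,\qquad \operatorname{H_1tr}A=\sup\{i \mid \operatorname{Ext}^i_{A^e}(A,A^e)\neq 0\},$$ $$\operatorname{H_2tr}A=\sup_U\ \operatorname{injdim}(A\otimes U),\qquad \operatorname{H_3tr}A=\sup_{U:\ A\otimes U\text{ noetherian}}\operatorname{injdim}(A\otimes U),$$ where $U$ ranges over all division algebras over $k$ (respectively those for which $A\otimes U$ is noetherian). A simple artinian algebra $S$ is called *homologically uniform* if $\operatorname{Htr}S=\operatorname{H_1tr}S=\operatorname{H_2tr}S<\infty$, *smooth* if $\operatorname{pdim}_{S^e}S<\infty$, and *rigid* if there are an integer $n$ and an automorphism $\sigma$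 of $S$ such that $\operatorname{Ext}^n_{S^e}(S,S^e)\cong S^\sigma$ as bimodules and $\operatorname{Ext}^i_{S^e}(S,S^e)=0$ for $i\ne n$; here $S^\sigma$ is $S$ with $a*s*b=as\sigma(b)$. An algebra $A$ is *doubly noetherian* if $A^e$ is noetherian. **Proposition 7.1.** Let $F$ be a separable algebraic field extension of $k$ with $\dim_kF=\aleph_0$. Then: (a) $F$ is smooth and homologically uniform, and $\operatorname{Htr}F=\operatorname{gldim}F^e=1$. (b) $F$ is not doubly noetherian. Every subfield $G$ with $k\subseteq G\subseteq F$ and $\dim_kG<\infty$ has $\operatorname{Htr}G=0$; in particular the supremum of $\operatorname{Htr}G$ over all such $G$ is $0<1=\operatorname{Htr}F$. (c) $\operatorname{H_3tr}F=\operatorname{tr}F=0$, where $\operatorname{tr}$ is the transcendence degree over $k$. (d) $F$ is not rigid; moreover $\operatorname{Ext}^1_{F^e}(F,F^e)$ is infinite dimensional over $F$. -/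

import Mathlib

open CategoryTheory
open scoped TensorProduct

universe u v w

noncomputable section

namespace HomTr

/-! ### Rings and their homological dimensions

Dimensions take values in `WithBot ℕ∞`; the supremum of the empty set and the dimension of the zero
module are `⊥`, that is `-∞`. Modules are left modules. -/

/-- The injective dimension of a ring as a left module over itself. -/
def injdim (R : Type v) [Ring R] : WithBot ℕ∞ :=
  injectiveDimension (ModuleCat.of.{v} R R)

/-- The (left) global dimension of a ring. -/
def gldim (R : Type v) [Ring R] : WithBot ℕ∞ :=
  ⨆ M : ModuleCat.{v} R, projectiveDimension M

/-- A (two-sided) noetherian ring. -/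
def IsNoetherianBothSides (R : Type v) [Ring R] : Prop :=
  IsNoetherianRing R ∧ IsNoetherianRing Rᵐᵒᵖ

variable (k : Type u) [Field k] (A : Type v) [Ring A] [Algebra k A]

/-- The enveloping algebra `A ⊗ Aᵒᵖ`. -/
abbrev Env : Type v := A ⊗[k] Aᵐᵒᵖ

/-- The algebra `A` as a left module over its enveloping algebra: `(a ⊗ b) • s = a * s * b`. -/
def diagonal : ModuleCat.{v} (Env k A) :=
  letI : Module (Env k A) A := TensorProduct.Algebra.module
  ModuleCat.of (Env k A) A

/-- The enveloping algebra as a left module over itself. -/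
abbrev envSelf : ModuleCat.{v} (Env k A) := ModuleCat.of (Env k A) (Env k A)

/-! ### The bimodules `Extⁱ(A, A ⊗ Aᵒᵖ)` -/

/-- The switch `a ⊗ b ↦ b ⊗ a`, an anti-automorphism of the enveloping algebra. -/
def switch : Env k A →ₗ[k] Env k A :=
  TensorProduct.map (MulOpposite.opLinearEquiv k (M := A)).symm.toLinearMap
    (MulOpposite.opLinearEquiv k (M := A)).toLinearMap ∘ₗ
      (TensorProduct.comm k A Aᵐᵒᵖ).toLinearMap

@[simp] lemma switch_tmul (a : A) (b : Aᵐᵒᵖ) :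
    switch k A (a ⊗ₜ b) = b.unop ⊗ₜ MulOpposite.op a := rfl

lemma switch_one : switch k A 1 = 1 := rfl

lemma switch_mul (x y : Env k A) : switch k A (x * y) = switch k A y * switch k A x := by
  induction x using TensorProduct.induction_on with
  | zero => simp
  | add x x' hx hx' => simp [add_mul, mul_add, hx, hx']
  | tmul a b =>
    induction y using TensorProduct.induction_on with
    | zero => simp
    | add y y' hy hy' => simp [add_mul, mul_add, hy, hy']
    | tmul c d => simp

/-- Right multiplication by `r`, an endomorphism of the left module `A ⊗ Aᵒᵖ`. -/
def rightMul (r : Env k A) : envSelf k A ⟶ envSelf k A :=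
  ModuleCat.ofHom (LinearMap.toSpanSingleton (Env k A) (Env k A) r)

lemma rightMul_one : rightMul k A 1 = 𝟙 _ := by
  ext
  simp [rightMul]

lemma rightMul_mul (r s : Env k A) :
    rightMul k A (r * s) = rightMul k A r ≫ rightMul k A s := by
  ext
  simp [rightMul]

lemma rightMul_add (r s : Env k A) :
    rightMul k A (r + s) = rightMul k A r + rightMul k A s := by
  ext
  simp [rightMul]

lemma rightMul_zero : rightMul k A 0 = 0 := by
  ext
  simp [rightMul]

/-- The bimodule structure on `Extⁱ(A, A ⊗ Aᵒᵖ)`, `Ext` over `A ⊗ Aᵒᵖ`, that comes from the right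
multiplications of the second argument: `a • ξ • b` is the image of `ξ` under right multiplication
by `switch (a ⊗ b) = b ⊗ a`. -/
abbrev extModule (i : ℕ) :
    Module (Env k A) (Abelian.Ext (diagonal k A) (envSelf k A) i) where
  smul r ξ := ξ.comp (Abelian.Ext.mk₀ (rightMul k A (switch k A r))) (add_zero i)
  one_smul ξ := by
    change ξ.comp (Abelian.Ext.mk₀ (rightMul k A (switch k A 1))) (add_zero i) = ξ
    rw [switch_one, rightMul_one, Abelian.Ext.comp_mk₀_id]
  mul_smul r s ξ := by
    change ξ.comp (Abelian.Ext.mk₀ (rightMul k A (switch k A (r * s)))) (add_zero i) =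
      (ξ.comp (Abelian.Ext.mk₀ (rightMul k A (switch k A s))) (add_zero i)).comp
        (Abelian.Ext.mk₀ (rightMul k A (switch k A r))) (add_zero i)
    rw [switch_mul, rightMul_mul, ← Abelian.Ext.mk₀_comp_mk₀,
      Abelian.Ext.comp_assoc_of_second_deg_zero]
  smul_zero r := by
    change (0 : Abelian.Ext (diagonal k A) (envSelf k A) i).comp
      (Abelian.Ext.mk₀ (rightMul k A (switch k A r))) (add_zero i) = 0
    rw [Abelian.Ext.zero_comp]
  smul_add r ξ η := Abelian.Ext.add_comp _ _ _ _
  add_smul r s ξ := by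
    change ξ.comp (Abelian.Ext.mk₀ (rightMul k A (switch k A (r + s)))) (add_zero i) =
      ξ.comp (Abelian.Ext.mk₀ (rightMul k A (switch k A r))) (add_zero i) +
      ξ.comp (Abelian.Ext.mk₀ (rightMul k A (switch k A s))) (add_zero i)
    rw [map_add, rightMul_add, Abelian.Ext.mk₀_add, Abelian.Ext.comp_add]
  zero_smul ξ := by
    change ξ.comp (Abelian.Ext.mk₀ (rightMul k A (switch k A 0))) (add_zero i) = 0
    rw [map_zero, rightMul_zero, Abelian.Ext.mk₀_zero, Abelian.Ext.comp_zero]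

/-- `Extⁱ(A, A ⊗ Aᵒᵖ)` over `A ⊗ Aᵒᵖ`, as an `A`-bimodule. -/
def extBimodule (i : ℕ) : ModuleCat.{v} (Env k A) :=
  letI := extModule k A i
  ModuleCat.of (Env k A) (Abelian.Ext (diagonal k A) (envSelf k A) i)

/-- `Extⁱ(A, A ⊗ Aᵒᵖ)` as a left `A`-module. -/
def extLeftModule (i : ℕ) : ModuleCat.{v} A :=
  (ModuleCat.restrictScalars
    (Algebra.TensorProduct.includeLeft : A →ₐ[k] Env k A).toRingHom).obj (extBimodule k A i)

variable {A} in
/-- The bimodule `A^σ`: the group `A` with `(a ⊗ b) • s = a * s * σ b`. -/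
def twisted (σ : A ≃ₐ[k] A) : ModuleCat.{v} (Env k A) :=
  (ModuleCat.restrictScalars
    (Algebra.TensorProduct.map (AlgHom.id k A) (AlgHom.op σ.toAlgHom)).toRingHom).obj
      (diagonal k A)

/-! ### Homological transcendence degrees -/

/-- The homological transcendence degree. -/
def htr : WithBot ℕ∞ := injdim (Env k A)

/-- The first modification of `htr`. -/
def fhtr : WithBot ℕ∞ :=
  ⨆ (i : ℕ) (_ : Nontrivial (Abelian.Ext (diagonal k A) (envSelf k A) i)), (i : WithBot ℕ∞)

/-- The second modification of `htr`; the universe `w` bounds the division algebras `U`. -/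
def shtr : WithBot ℕ∞ :=
  ⨆ (U : Type w) (_ : DivisionRing U) (_ : Algebra k U), injdim (A ⊗[k] U)

/-- The third modification of `htr`; the universe `w` bounds the division algebras `U`. -/
def thtr : WithBot ℕ∞ :=
  ⨆ (U : Type w) (_ : DivisionRing U) (_ : Algebra k U)
    (_ : IsNoetherianBothSides (A ⊗[k] U)), injdim (A ⊗[k] U)

/-- An algebra is doubly noetherian if its enveloping algebra is noetherian. -/
def IsDoublyNoetherian : Prop := IsNoetherianBothSides (Env k A)

/-- Homologically uniform simple artinian algebras. -/
def IsHomologicallyUniform [IsSimpleRing A] [IsArtinianRing A] : Prop :=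
  htr k A = fhtr k A ∧ fhtr k A = shtr.{u, v, w} k A ∧ shtr.{u, v, w} k A < ⊤

/-- Smooth simple artinian algebras. -/
def IsSmooth [IsSimpleRing A] [IsArtinianRing A] : Prop :=
  projectiveDimension (diagonal k A) < ⊤

/-- Rigid simple artinian algebras: `Ext` of `A` into `A ⊗ Aᵒᵖ` is concentrated in one degree `n`,
where it is isomorphic, as a bimodule, to `A^σ` for some automorphism `σ`. -/
def IsRigid [IsSimpleRing A] [IsArtinianRing A] : Prop :=
  ∃ (n : ℕ) (σ : A ≃ₐ[k] A), Nonempty (extBimodule k A n ≅ twisted k σ) ∧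
    ∀ i : ℕ, i ≠ n → Subsingleton (Abelian.Ext (diagonal k A) (envSelf k A) i)

end HomTr

end

/-! `F` is the directed union of its finite subextensions `G`, and countably many of these suffice.
For a division algebra `U`, each `G ⊗ U` is noetherian, being finite over `U`, and von Neumann
regular, by averaging over the separability idempotent of `G`. Hence `F ⊗ U` is regular with
countably generated left ideals. Such an ideal is exhausted by an increasing sequence of
idempotents, so it is projective (`IsExhausting.projective`). Thus `F ⊗ U` is left hereditary, which
gives all upper bounds `1`. If `F ⊗ U` is noetherian, its left ideals are generated by idempotents
and Baer's criterion gives self-injectivity, hence the value `0`.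

All lower bounds `1` come from `Ext¹(F, Fᵉ) ≠ 0`. The kernel `J` of multiplication is not generated
by an idempotent, since `F` is infinite over `k`, so its exhausting sequence can be made strictly
increasing. Scaling the components of `J` by a sequence in `F` gives a homomorphism `J → Fᵉ`, hence
a class in `Ext¹`, which vanishes only if the homomorphism is multiplication by one element of `Fᵉ`.
Sequences form a space of uncountable dimension over `F`, while `Fᵉ` has countable dimension, so
`Ext¹` is infinite dimensional. This also excludes rigidity, as `F^σ` is one-dimensional. -/

noncomputable section

namespace HomTr

/-! ### Von Neumann regular rings -/

/-- A ring is von Neumann regular if every `x` has a quasi-inverse `y`: `x * y * x = x`. -/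
def IsVonNeumannRegular (R : Type*) [Ring R] : Prop :=
  ∀ x : R, ∃ y : R, x * y * x = x

/-! ### Idempotents and countably generated left ideals -/

section Regular

variable {R : Type v} [Ring R]

/-- With `z = x(1 - e)` and a quasi-inverse `y` of `z`, the idempotent `g = yz` satisfies `ge = 0`
and `zg = z`. Take `1 - f = (1 - e)(1 - g)`: then `f` fixes `e`, `g` and `z` from the right, hence
also `x = z + xe`. -/
lemma IsVonNeumannRegular.exists_idempotent_extend (hR : IsVonNeumannRegular R) {I : Ideal R}
    {e x : R} (he : e ∈ I) (hee : e * e = e) (hx : x ∈ I) :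
    ∃ f ∈ I, f * f = f ∧ e * f = e ∧ x * f = x := by
  obtain ⟨y, hy⟩ := hR (x - x * e)
  set z := x - x * e with hz
  have hze : z * e = 0 := by rw [hz, sub_mul, mul_assoc, hee, sub_self]
  have hzI : z ∈ I := I.sub_mem hx (I.mul_mem_left _ he)
  set g := y * z with hg
  have hge : g * e = 0 := by rw [hg, mul_assoc, hze, mul_zero]
  have hzg : z * g = z := by rw [hg, ← mul_assoc, hy]
  have hgg : g * g = g := by rw [hg, mul_assoc, ← hg, hzg]
  have hgI : g ∈ I := I.mul_mem_left _ hzI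
  have hef : e * (e + g - e * g) = e := by
    rw [mul_sub, mul_add, ← mul_assoc e e, hee, add_sub_cancel_right]
  have hgf : g * (e + g - e * g) = g := by
    rw [mul_sub, mul_add, ← mul_assoc g e, hge, hgg, zero_mul, zero_add, sub_zero]
  have hzf : z * (e + g - e * g) = z := by
    rw [mul_sub, mul_add, ← mul_assoc z e, hze, hzg, zero_mul, zero_add, sub_zero]
  refine ⟨e + g - e * g, I.sub_mem (I.add_mem he hgI) (I.mul_mem_left _ hgI), ?_, hef, ?_⟩
  · conv_lhs => rw [sub_mul, add_mul, mul_assoc e g, hef, hgf]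
  · have : x = z + x * e := by rw [hz, sub_add_cancel]
    conv_lhs => rw [this, add_mul, hzf, mul_assoc, hef]
    exact this.symm

lemma mul_eq_self_of_mem_span {S : Set R} {e : R} (h : ∀ x ∈ S, x * e = x) {x : R}
    (hx : x ∈ Ideal.span S) : x * e = x := by
  induction hx using Submodule.span_induction with
  | mem x hx => exact h x hx
  | zero => simp
  | add x y _ _ hx hy => rw [add_mul, hx, hy]
  | smul a x _ hx => rw [smul_eq_mul, mul_assoc, hx]

lemma IsVonNeumannRegular.exists_idempotent_of_fg (hR : IsVonNeumannRegular R) {I : Ideal R}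
    (hI : I.FG) : ∃ e ∈ I, ∀ x ∈ I, x * e = x := by
  classical
  obtain ⟨S, rfl⟩ := hI
  suffices H : ∀ T : Finset R, T ⊆ S → ∃ e ∈ Ideal.span (S : Set R), e * e = e ∧
      ∀ x ∈ T, x * e = x by
    obtain ⟨e, he, -, h⟩ := H S subset_rfl
    exact ⟨e, he, fun x hx => mul_eq_self_of_mem_span h hx⟩
  intro T
  induction T using Finset.induction_on with
  | empty => exact fun _ => ⟨0, zero_mem _, by simp, by simp⟩
  | insert a T _ ih =>
    intro hT
    rw [Finset.insert_subset_iff] at hT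
    obtain ⟨e, he, hee, h⟩ := ih hT.2
    obtain ⟨f, hf, hff, hef, haf⟩ :=
      hR.exists_idempotent_extend he hee (Ideal.subset_span (Finset.mem_coe.2 hT.1))
    refine ⟨f, hf, hff, fun x hx => ?_⟩
    rcases Finset.mem_insert.1 hx with rfl | hx
    · exact haf
    · rw [← h x hx, mul_assoc, hef]

/-- An increasing sequence of idempotents that exhausts a left ideal. -/
structure IsExhausting (I : Ideal R) (e : ℕ → R) : Prop where
  zero : e 0 = 0
  mem : ∀ n, e n ∈ I
  mul_self : ∀ n, e n * e n = e n
  mul_succ : ∀ n, e n * e (n + 1) = e n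
  eventually : ∀ x ∈ I, ∃ N, ∀ n, N ≤ n → x * e n = x

/-- Recursion from `0`, absorbing the generator `x n` at stage `n`. The relation `Q` leaves room to
demand strict growth. -/
lemma exists_isExhausting_of_step {I : Ideal R} {Q : R → R → Prop} (x : ℕ → R)
    (hx : Ideal.span (Set.range x) = I)
    (step : ∀ e ∈ I, e * e = e → ∀ y ∈ I, ∃ f ∈ I, f * f = f ∧ e * f = e ∧ y * f = y ∧ Q e f) :
    ∃ e : ℕ → R, IsExhausting I e ∧ ∀ n, Q (e n) (e (n + 1)) := by
  have hxI : ∀ n, x n ∈ I := fun n => hx ▸ Ideal.subset_span ⟨n, rfl⟩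
  choose! f hfI hff hef hyf hQ using step
  let e : ℕ → R := fun n => Nat.rec 0 (fun n e => f e (x n)) n
  have hs : ∀ n, e (n + 1) = f (e n) (x n) := fun n => rfl
  have he : ∀ n, e n ∈ I ∧ e n * e n = e n := by
    intro n
    induction n with
    | zero => exact ⟨zero_mem _, zero_mul _⟩
    | succ n ih =>
      rw [hs]
      exact ⟨hfI _ ih.1 ih.2 _ (hxI n), hff _ ih.1 ih.2 _ (hxI n)⟩
  have hmul : ∀ n, e n * e (n + 1) = e n := fun n => by
    conv_lhs => rw [hs, hef _ (he n).1 (he n).2 _ (hxI n)]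
  refine ⟨e, ⟨rfl, fun n => (he n).1, fun n => (he n).2, hmul, fun y hy => ?_⟩,
    fun n => hQ _ (he n).1 (he n).2 _ (hxI n)⟩
  rw [← hx] at hy
  induction hy using Submodule.span_induction with
  | mem y hy =>
    obtain ⟨m, rfl⟩ := hy
    refine ⟨m + 1, fun n hn => ?_⟩
    induction n, hn using Nat.le_induction with
    | base => rw [hs]; exact hyf _ (he m).1 (he m).2 _ (hxI m)
    | succ n _ ih => conv_rhs => rw [← ih]
                     conv_lhs => rw [← ih, mul_assoc, hmul]
  | zero => exact ⟨0, by simp⟩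
  | add y z _ _ hy hz =>
    obtain ⟨M, hM⟩ := hy
    obtain ⟨N, hN⟩ := hz
    exact ⟨max M N, fun n hn => by
      rw [add_mul, hM n (le_of_max_le_left hn), hN n (le_of_max_le_right hn)]⟩
  | smul a y _ hy =>
    obtain ⟨M, hM⟩ := hy
    exact ⟨M, fun n hn => by rw [smul_eq_mul, mul_assoc, hM n hn]⟩

lemma IsVonNeumannRegular.exists_isExhausting (hR : IsVonNeumannRegular R) {I : Ideal R}
    (x : ℕ → R) (hx : Ideal.span (Set.range x) = I) : ∃ e : ℕ → R, IsExhausting I e := by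
  obtain ⟨e, he, -⟩ := exists_isExhausting_of_step (I := I) (Q := fun _ _ => True) x hx
    fun e he hee y hy => by
      simpa using hR.exists_idempotent_extend he hee hy
  exact ⟨e, he⟩

lemma IsVonNeumannRegular.exists_isExhausting_strict (hR : IsVonNeumannRegular R) {I : Ideal R}
    (x : ℕ → R) (hx : Ideal.span (Set.range x) = I)
    (hI : ∀ e ∈ I, ∃ y ∈ I, y * e ≠ y) :
    ∃ e : ℕ → R, IsExhausting I e ∧ ∀ n, e n ≠ e (n + 1) := by
  refine exists_isExhausting_of_step x hx fun e he hee y hy => ?_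
  obtain ⟨f, hf, hff, hef, hyf⟩ := hR.exists_idempotent_extend he hee hy
  -- A second enlargement absorbs some `z` that `e` does not fix, which forces `g ≠ e`.
  obtain ⟨z, hz, hze⟩ := hI e he
  obtain ⟨g, hg, hgg, hfg, hzg⟩ := hR.exists_idempotent_extend hf hff hz
  refine ⟨g, hg, hgg, ?_, ?_, ?_⟩
  · rw [← hef, mul_assoc, hfg]
  · rw [← hyf, mul_assoc, hfg]
  · rintro rfl
    exact hze hzg

/-- The components `x * (e (n + 1) - e n)` of the elements of an exhausted left ideal. -/
def IsExhausting.components {I : Ideal R} {e : ℕ → R} (he : IsExhausting I e) :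
    I →ₗ[R] ℕ →₀ R where
  toFun x := Finsupp.ofSupportFinite (fun n => (x : R) * (e (n + 1) - e n)) <| by
    obtain ⟨N, hN⟩ := he.eventually x x.2
    refine (Set.finite_lt_nat N).subset fun n hn => ?_
    by_contra h
    simp only [Set.mem_ofPred_eq, not_lt] at h
    exact hn (by simp only [mul_sub, hN n h, hN (n + 1) (by lia), sub_self])
  map_add' x y := by ext n; exact add_mul _ _ _
  map_smul' r x := by ext n; exact mul_assoc _ _ _

lemma IsExhausting.components_apply {I : Ideal R} {e : ℕ → R} (he : IsExhausting I e) (x : I)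
    (n : ℕ) : he.components x n = (x : R) * (e (n + 1) - e n) := rfl

/-- The components split `I` off a free module: `x = ∑ x(e (n + 1) - e n) e (n + 1)`, because the
sum telescopes to `x * e N` for large `N`. -/
lemma IsExhausting.projective {I : Ideal R} {e : ℕ → R} (he : IsExhausting I e) :
    Module.Projective R I := by
  refine Module.Projective.of_split he.components
    (Finsupp.linearCombination R fun n => (⟨e (n + 1), he.mem _⟩ : I)) ?_
  ext x
  obtain ⟨N, hN⟩ := he.eventually x x.2
  have hsub : (he.components x).support ⊆ Finset.range N := by
    intro n hn
    by_contra h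
    rw [Finset.mem_range, not_lt] at h
    rw [Finsupp.mem_support_iff, he.components_apply, mul_sub, hN n h, hN (n + 1) (by lia)] at hn
    exact hn (sub_self _)
  rw [LinearMap.comp_apply, Finsupp.linearCombination_apply,
    Finsupp.sum_of_support_subset _ hsub _ (by simp)]
  have hterm : ∀ n, ((he.components x n • (⟨e (n + 1), he.mem _⟩ : I) : I) : R) =
      (x : R) * e (n + 1) - x * e n := fun n => by
    rw [Submodule.coe_smul, he.components_apply, smul_eq_mul, mul_assoc, sub_mul, he.mul_succ,
      he.mul_self,
      mul_sub]
  rw [Submodule.coe_sum, Finset.sum_congr rfl fun n _ => hterm n,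
    Finset.sum_range_sub (fun n => (x : R) * e n), he.zero,
    hN N le_rfl]
  simp

end Regular

/-! ### Homological dimensions from ideals -/

section Dimension

variable {R : Type v} [Ring R]

lemma IsVonNeumannRegular.baer_of_isNoetherianRing (hR : IsVonNeumannRegular R)
    [IsNoetherianRing R] : Module.Baer R R := by
  intro I g
  obtain ⟨e, he, h⟩ := hR.exists_idempotent_of_fg (IsNoetherian.noetherian I)
  refine ⟨LinearMap.toSpanSingleton R R (g ⟨e, he⟩), fun x hx => ?_⟩
  rw [LinearMap.toSpanSingleton_apply, ← map_smul]
  congr 1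
  exact Subtype.ext (h x hx)

lemma zero_le_injdim [Nontrivial R] : 0 ≤ injdim R := by
  refine (injectiveDimension_ge_iff (ModuleCat.of R R) 0).2 fun h => ?_
  have := (hasInjectiveDimensionLT_zero_iff_isZero _).1 h
  rw [ModuleCat.isZero_iff_subsingleton] at this
  exact not_subsingleton R this

lemma IsVonNeumannRegular.injdim_eq_zero (hR : IsVonNeumannRegular R) [IsNoetherianRing R]
    [Nontrivial R] : injdim R = 0 := by
  refine le_antisymm ((injectiveDimension_le_iff (ModuleCat.of R R) 0).2 ?_) zero_le_injdim
  have : Injective (ModuleCat.of R R) :=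
    (Module.injective_iff_injective_object R R).1 hR.baer_of_isNoetherianRing.injective
  infer_instance

/-- Over a left hereditary ring every module has injective dimension at most one. -/
lemma hasInjectiveDimensionLT_two_of_projective (h : ∀ I : Ideal R, Module.Projective R I)
    (N : ModuleCat.{v} R) : HasInjectiveDimensionLT N 2 := by
  let ⟨E, _, f, _⟩ := EnoughInjectives.presentation N
  have hE : Module.Injective R E := Module.injective_module_of_injective_object R E
  have hf : Function.Injective f.hom := (ModuleCat.mono_iff_injective f).1 ‹_›
  let S : ShortComplex (ModuleCat.{v} R) :=
    ModuleCat.shortComplexOfCompEqZero _ _ f.hom.exact_map_mkQ_range.linearMap_comp_eq_zero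
  have hS : S.ShortExact := ModuleCat.shortComplex_shortExact S
    f.hom.exact_map_mkQ_range hf (Submodule.mkQ_surjective _)
  -- A map from `I` to the quotient lifts to `E` by projectivity of `I`, then extends to `R` by
  -- injectivity of `E`.
  have hQ : Module.Baer R (E ⧸ f.hom.range) := by
    intro I g
    have := h I
    obtain ⟨g₁, hg₁⟩ := Module.projective_lifting_property (f.hom.range.mkQ) g
      (Submodule.mkQ_surjective _)
    obtain ⟨g₂, hg₂⟩ := Module.Baer.of_injective hE I g₁
    refine ⟨f.hom.range.mkQ ∘ₗ g₂, fun x hx => ?_⟩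
    rw [LinearMap.comp_apply, hg₂ x hx, ← hg₁, LinearMap.comp_apply]
  have : Injective S.X₃ :=
    (Module.injective_iff_injective_object R (E ⧸ f.hom.range)).1 hQ.injective
  have : Injective S.X₂ := ‹Injective E›
  exact hS.hasInjectiveDimensionLT_X₁ 1 inferInstance inferInstance

lemma injdim_le_one_of_projective (h : ∀ I : Ideal R, Module.Projective R I) : injdim R ≤ 1 :=
  (injectiveDimension_le_iff (ModuleCat.of R R) 1).2
    (hasInjectiveDimensionLT_two_of_projective h _)

lemma hasProjectiveDimensionLT_two_of_projective (h : ∀ I : Ideal R, Module.Projective R I)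
    (M : ModuleCat.{v} R) : HasProjectiveDimensionLT M 2 :=
  HasProjectiveDimensionLT.mk fun _ hi Y e =>
    have := hasInjectiveDimensionLT_two_of_projective h Y
    e.eq_zero_of_hasInjectiveDimensionLT 2 hi

lemma projectiveDimension_le_one_of_projective (h : ∀ I : Ideal R, Module.Projective R I)
    (M : ModuleCat.{v} R) : projectiveDimension M ≤ 1 :=
  (projectiveDimension_le_iff M 1).2 (hasProjectiveDimensionLT_two_of_projective h M)

lemma gldim_le_one_of_projective (h : ∀ I : Ideal R, Module.Projective R I) : gldim R ≤ 1 :=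
  iSup_le (projectiveDimension_le_one_of_projective h)

attribute [local instance] RingHomInvPair.of_ringEquiv in
lemma injdim_eq_of_ringEquiv {S : Type w} [Ring S] (e : R ≃+* S) : injdim R = injdim S :=
  ModuleCat.injectiveDimension_eq_of_semiLinearEquiv e (M := ModuleCat.of R R)
    (N := ModuleCat.of S S) e.toSemilinearEquiv

end Dimension

/-! ### Tensor products of separable extensions with division algebras -/

section SeparableTensor

variable {k : Type u} [Field k]

section FiniteSeparable

variable {G : Type v} [Field G] [Algebra k G] {U : Type w} [DivisionRing U] [Algebra k U]

variable (k G U) in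
/-- The left `U`-module structure on `G ⊗ U` that comes from the second factor. -/
abbrev rightFactorModule : Module U (G ⊗[k] U) :=
  Module.compHom _ (Algebra.TensorProduct.includeRight : U →ₐ[k] G ⊗[k] U).toRingHom

attribute [local instance] rightFactorModule

lemma rightFactor_smul (x : U) (b : G ⊗[k] U) : x • b = ((1 : G) ⊗ₜ[k] x) * b := rfl

lemma rightFactor_isScalarTower : IsScalarTower k U (G ⊗[k] U) :=
  ⟨fun c x b => by
    rw [rightFactor_smul, rightFactor_smul, TensorProduct.tmul_smul, smul_mul_assoc]⟩

attribute [local instance] rightFactor_isScalarTower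

variable (k G U) in
lemma isNoetherianRing_tensor [FiniteDimensional k G] : IsNoetherianRing (G ⊗[k] U) := by
  have : IsScalarTower U (G ⊗[k] U) (G ⊗[k] U) :=
    ⟨fun x b c => by simp only [rightFactor_smul, smul_eq_mul, mul_assoc]⟩
  classical
  let b := Module.finBasis k G
  have : Module.Finite U (G ⊗[k] U) := by
    refine ⟨⟨Finset.univ.image fun i => b i ⊗ₜ[k] (1 : U), top_le_iff.1 fun x _ => ?_⟩⟩
    induction x using TensorProduct.induction_on with
    | zero => exact zero_mem _
    | add x y hx hy => exact add_mem (hx trivial) (hy trivial)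
    | tmul g y =>
      have : g ⊗ₜ[k] y = ∑ i, (b.repr g i • y) • (b i ⊗ₜ[k] (1 : U)) := by
        conv_lhs => rw [← b.sum_repr g, TensorProduct.sum_tmul]
        refine Finset.sum_congr rfl fun i _ => ?_
        rw [rightFactor_smul, Algebra.TensorProduct.tmul_mul_tmul, one_mul, mul_one,
          TensorProduct.smul_tmul]
      rw [this]
      exact sum_mem fun i _ => Submodule.smul_mem _ _ (Submodule.subset_span (by simp))
  exact isNoetherian_of_tower U inferInstance

lemma exists_linearMap_comp_comp {D : Type*} [DivisionRing D] {V W : Type*} [AddCommGroup V]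
    [Module D V] [AddCommGroup W] [Module D W] (f : V →ₗ[D] W) :
    ∃ g : W →ₗ[D] V, ∀ v, f (g (f v)) = f v := by
  obtain ⟨p, hp⟩ := f.range.subtype.exists_leftInverse_of_injective f.range.ker_subtype
  obtain ⟨q, hq⟩ := f.rangeRestrict.exists_rightInverse_of_surjective f.range_rangeRestrict
  refine ⟨q ∘ₗ p, fun v => ?_⟩
  have h1 : p (f v) = f.rangeRestrict v := LinearMap.congr_fun hp (f.rangeRestrict v)
  have h2 := LinearMap.congr_fun hq (f.rangeRestrict v)
  rw [LinearMap.comp_apply, h1]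
  exact congrArg Subtype.val h2

variable (k G U) in
-- Right multiplication by `x` has a left `U`-linear quasi-inverse `ψ`. Averaging `ψ` over the
-- separability idempotent makes it `G ⊗ U`-linear, hence right multiplication by its value at `1`,
-- which is the quasi-inverse of `x`.
lemma isVonNeumannRegular_tensor_of_finite [FiniteDimensional k G] [Algebra.IsSeparable k G] :
    IsVonNeumannRegular (G ⊗[k] U) := by
  have : Algebra.FormallyUnramified k G := .of_isSeparable k G
  intro x
  let f : G ⊗[k] U →ₗ[U] G ⊗[k] U :=
    { toFun := fun b => b * x
      map_add' := fun a b => add_mul a b x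
      map_smul' := fun a b => mul_assoc _ _ _ }
  obtain ⟨ψ, hψ⟩ := exists_linearMap_comp_comp f
  have hψx : ∀ b : G ⊗[k] U, ψ (b * x) * x = b * x := hψ
  have hψU : ∀ (y : U) (b : G ⊗[k] U), ψ ((1 ⊗ₜ y) * b) = (1 ⊗ₜ y) * ψ b :=
    fun y b => ψ.map_smul y b
  let j : G →ₐ[k] G ⊗[k] U := Algebra.TensorProduct.includeLeft
  let T (b : G ⊗[k] U) : G ⊗[k] G →ₗ[k] G ⊗[k] U :=
    TensorProduct.lift ((LinearMap.mul k (G ⊗[k] U)).compl₁₂ j.toLinearMap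
      ((ψ.restrictScalars k) ∘ₗ (LinearMap.mulRight k b) ∘ₗ j.toLinearMap))
  have hT : ∀ b g h, T b (g ⊗ₜ h) = (g ⊗ₜ 1) * ψ ((h ⊗ₜ 1) * b) := fun b g h => rfl
  have hTadd : ∀ b c t, T (b + c) t = T b t + T c t := by
    intro b c t
    induction t using TensorProduct.induction_on with
    | zero => simp
    | add s t hs ht => rw [map_add, map_add, map_add, hs, ht]; abel
    | tmul g h => simp only [hT, mul_add, map_add]
  have hTG : ∀ (a : G) (t : G ⊗[k] G), (a ⊗ₜ 1) * T 1 t = T 1 ((a ⊗ₜ 1) * t) := by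
    intro a t
    induction t using TensorProduct.induction_on with
    | zero => simp
    | add s t hs ht => rw [map_add, mul_add, mul_add, map_add, hs, ht]
    | tmul g h =>
      simp only [hT, Algebra.TensorProduct.tmul_mul_tmul, ← mul_assoc, one_mul]
  have hTU : ∀ (a : G) (y : U) (t : G ⊗[k] G),
      (1 ⊗ₜ y) * T 1 ((1 ⊗ₜ a) * t) = T (a ⊗ₜ y) t := by
    intro a y t
    induction t using TensorProduct.induction_on with
    | zero => simp
    | add s t hs ht => rw [map_add, mul_add, map_add, mul_add, hs, ht]
    | tmul g h =>
      simp only [hT, Algebra.TensorProduct.tmul_mul_tmul, mul_one, one_mul]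
      rw [← mul_assoc, Algebra.TensorProduct.tmul_mul_tmul, mul_one, one_mul,
        show (g ⊗ₜ[k] y : G ⊗[k] U) = (g ⊗ₜ 1) * (1 ⊗ₜ y) by simp, mul_assoc, ← hψU,
        Algebra.TensorProduct.tmul_mul_tmul, mul_one, one_mul, mul_comm a h]
  let t := Algebra.FormallyUnramified.elem k G
  -- Linearity of the averaged map `b ↦ T b t`: over `G` it rests on `(a ⊗ 1)t = (1 ⊗ a)t`, over `U`
  -- on that of `ψ`.
  have hmul : ∀ b : G ⊗[k] U, b * T 1 t = T b t := by
    intro b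
    induction b using TensorProduct.induction_on with
    | zero =>
      have := hTadd 0 0 t
      rw [zero_add, left_eq_add] at this
      rw [zero_mul, this]
    | add b c hb hc => rw [add_mul, hb, hc, hTadd]
    | tmul a y =>
      rw [show (a ⊗ₜ[k] y : G ⊗[k] U) = (1 ⊗ₜ y) * (a ⊗ₜ 1) by simp, mul_assoc, hTG,
        ← Algebra.FormallyUnramified.one_tmul_mul_elem, hTU,
        Algebra.TensorProduct.tmul_mul_tmul, one_mul, mul_one]
  -- Multiplying by `x` removes `ψ`, since `ψ (hx) x = hx`; what remains is the product of the
  -- tensor factors, equal to `1` for `t`.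
  have hlast : ∀ s : G ⊗[k] G,
      T x s * x = (Algebra.TensorProduct.lmul' k s ⊗ₜ 1) * x := by
    intro s
    induction s using TensorProduct.induction_on with
    | zero => simp
    | add s t hs ht => rw [map_add, map_add, add_mul, hs, ht, TensorProduct.add_tmul, add_mul]
    | tmul g h =>
      rw [hT, mul_assoc, hψx, ← mul_assoc]
      simp
  refine ⟨T 1 t, ?_⟩
  rw [hmul, hlast, Algebra.FormallyUnramified.lmul_elem, ← Algebra.TensorProduct.one_def, one_mul]

end FiniteSeparable

section Countable

variable {F : Type v} [Field F] [Algebra k F] {U : Type w} [DivisionRing U] [Algebra k U]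

/-- Every element of `F ⊗ U` comes from a subfield generated by finitely many basis elements. -/
lemma exists_mem_range_map_adjoin {ι : Type*} (b : Module.Basis ι k F) (x : F ⊗[k] U) :
    ∃ s : Finset ι, x ∈ (Algebra.TensorProduct.map (IntermediateField.adjoin k (b '' s)).val
      (AlgHom.id k U)).range := by
  classical
  obtain ⟨m, rfl⟩ := (TensorProduct.equivFinsuppOfBasisLeft b (N := U)).symm.surjective x
  refine ⟨m.support, ?_⟩
  rw [TensorProduct.equivFinsuppOfBasisLeft_symm_apply]
  refine sum_mem fun i hi => ?_
  exact ⟨⟨b i, IntermediateField.subset_adjoin k _ ⟨i, hi, rfl⟩⟩ ⊗ₜ m i, by simp⟩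

variable (k) in
lemma finiteDimensional_adjoin_image [Algebra.IsAlgebraic k F] {ι : Type*} (b : ι → F)
    (s : Finset ι) : FiniteDimensional k (IntermediateField.adjoin k (b '' s)) :=
  have := (s.finite_toSet.image b).to_subtype
  IntermediateField.finiteDimensional_adjoin fun x _ => Algebra.IsIntegral.isIntegral x

variable (k F U) in
lemma isVonNeumannRegular_tensor [Algebra.IsSeparable k F] : IsVonNeumannRegular (F ⊗[k] U) := by
  intro x
  obtain ⟨s, x, rfl⟩ := exists_mem_range_map_adjoin (Module.Basis.ofVectorSpace k F) x
  have := finiteDimensional_adjoin_image k (Module.Basis.ofVectorSpace k F) s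
  obtain ⟨y, hy⟩ := isVonNeumannRegular_tensor_of_finite k _ U x
  let φ := Algebra.TensorProduct.map (IntermediateField.adjoin k
    (Module.Basis.ofVectorSpace k F '' s)).val (AlgHom.id k U)
  refine ⟨φ y, ?_⟩
  have h := congrArg φ hy
  rwa [map_mul, map_mul] at h

/-- There are countably many finite sets of basis vectors, and the trace of `I` on each
corresponding noetherian subring is finitely generated. -/
lemma exists_span_range_eq {ι : Type*} [Countable ι] (b : Module.Basis ι k F)
    [Algebra.IsAlgebraic k F] (I : Ideal (F ⊗[k] U)) :
    ∃ x : ℕ → F ⊗[k] U, Ideal.span (Set.range x) = I := by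
  let φ (s : Finset ι) := Algebra.TensorProduct.map (IntermediateField.adjoin k (b '' s)).val
      (AlgHom.id k U)
  have hfg : ∀ s : Finset ι, (I.comap (φ s)).FG := fun s =>
    have := finiteDimensional_adjoin_image k b s
    have := isNoetherianRing_tensor k (IntermediateField.adjoin k (b '' s)) U
    IsNoetherian.noetherian _
  choose T hT using hfg
  -- The element `0` makes the set nonempty, so that `ℕ` enumerates it.
  let S : Set (F ⊗[k] U) := insert 0 (⋃ s, φ s '' T s)
  have hS : S.Countable := (Set.countable_iUnion fun s => ((T s).countable_toSet.image _)).insert _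
  obtain ⟨x, hx⟩ := hS.exists_eq_range ⟨0, Set.mem_insert _ _⟩
  refine ⟨x, ?_⟩
  rw [← hx]
  apply le_antisymm
  · rw [Ideal.span_le]
    refine Set.insert_subset (zero_mem I) (Set.iUnion_subset fun s => ?_)
    rintro _ ⟨t, ht, rfl⟩
    have : t ∈ I.comap (φ s) := by rw [← hT s]; exact Ideal.subset_span ht
    exact this
  · intro y hy
    obtain ⟨s, y, rfl⟩ := exists_mem_range_map_adjoin b y
    have : y ∈ I.comap (φ s) := hy
    rw [← hT s] at this
    have h2 := Ideal.mem_map_of_mem (φ s) this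
    have h3 := Ideal.map_span (φ s) (T s : Set _)
    rw [h3] at h2
    exact Ideal.span_mono ((Set.subset_iUnion (fun s => φ s '' T s) s).trans
      (Set.subset_insert _ _)) h2

lemma projective_ideal_tensor [Algebra.IsSeparable k F]
    (hdim : Module.rank k F = Cardinal.aleph0) (I : Ideal (F ⊗[k] U)) :
    Module.Projective (F ⊗[k] U) I := by
  let b := Module.Basis.ofVectorSpace k F
  have : Countable (Module.Basis.ofVectorSpaceIndex k F) := by
    rw [← Cardinal.mk_le_aleph0_iff, b.mk_eq_rank'', hdim]
  obtain ⟨x, hx⟩ := exists_span_range_eq b I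
  obtain ⟨e, he⟩ := (isVonNeumannRegular_tensor k F U).exists_isExhausting x hx
  exact he.projective

end Countable

end SeparableTensor

/-! ### Orthogonal differences of idempotents, and a dimension count -/

section Idempotents

variable {R : Type v} [CommRing R] {I : Ideal R} {e : ℕ → R}

lemma IsExhausting.mul_of_le (he : IsExhausting I e) {m n : ℕ} (h : m ≤ n) : e m * e n = e m := by
  induction n, h using Nat.le_induction with
  | base => exact he.mul_self m
  | succ n _ ih => rw [← ih, mul_assoc, he.mul_succ]

lemma IsExhausting.mul_eq_min (he : IsExhausting I e) (m n : ℕ) : e m * e n = e (min m n) := by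
  rcases le_total m n with h | h
  · rw [he.mul_of_le h, min_eq_left h]
  · rw [mul_comm, he.mul_of_le h, min_eq_right h]

lemma IsExhausting.components_sub (he : IsExhausting I e) (m : ℕ) :
    he.components (⟨e (m + 1), he.mem _⟩ - ⟨e m, he.mem _⟩) =
      Finsupp.single m (e (m + 1) - e m) := by
  ext n
  rw [he.components_apply, Submodule.coe_sub, sub_mul, mul_sub, mul_sub, Finsupp.single_apply]
  simp only [he.mul_eq_min]
  split_ifs with h
  · subst h
    simp
  · rcases Nat.lt_or_gt_of_ne h with h | h
    · rw [min_eq_left (by lia : m + 1 ≤ n + 1), min_eq_left (by lia : m + 1 ≤ n),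
        min_eq_left (by lia : m ≤ n + 1), min_eq_left (by lia : m ≤ n)]
      simp
    · rw [min_eq_right (by lia : n + 1 ≤ m + 1), min_eq_right (by lia : n ≤ m + 1),
        min_eq_right (by lia : n + 1 ≤ m), min_eq_right (by lia : n ≤ m)]
      simp

end Idempotents

/-- By Erdős–Kaplansky the dimension is the cardinality of `ℕ → F`, at least `2 ^ ℵ₀`. -/
lemma aleph0_lt_rank_nat_fun (F : Type v) [Field F] :
    Cardinal.aleph0 < Module.rank F (ℕ → F) := by
  rw [rank_fun_infinite, Cardinal.mk_arrow, Cardinal.mk_nat, Cardinal.lift_aleph0,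
    Cardinal.lift_uzero]
  refine (Cardinal.cantor Cardinal.aleph0).trans_le (Cardinal.power_le_power_right ?_)
  exact Cardinal.two_le_iff.2 ⟨0, 1, zero_ne_one⟩

/-- If a linear map from the space of all sequences in `F` identifies only sequences that differ
by an element of a ring of countable dimension, then its codomain is infinite dimensional. -/
lemma not_finite_of_linearMap {F E R : Type v} [Field F] [AddCommGroup E] [Module F E] [CommRing R]
    (ρ : F →+* R) {S : Set R} (hS : S.Countable)
    (hspan : ∀ p : AddSubgroup R, S ⊆ p → (∀ c, ∀ x ∈ p, ρ c * x ∈ p) → p = ⊤)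
    {f : ℕ → R} (hf : ∀ n, f n ≠ 0) (Ψ : (ℕ → F) →ₗ[F] E)
    (hΨ : ∀ a, Ψ a = 0 → ∃ r, ∀ n, f n * ρ (a n) = f n * r) : ¬ Module.Finite F E := by
  intro hE
  let : Module F R := Module.compHom R ρ
  have hsmul : ∀ (c : F) (x : R), c • x = ρ c * x := fun c x => rfl
  have hR : Module.rank F R ≤ Cardinal.aleph0 := by
    have h : Submodule.span F S = ⊤ := by
      rw [← Submodule.toAddSubgroup_inj]
      exact hspan _ Submodule.subset_span fun c x hx => Submodule.smul_mem (Submodule.span F S) c hx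
    rw [← rank_top, ← h]
    exact (rank_span_le S).trans hS.le_aleph0
  let L : R →ₗ[F] ℕ → R := LinearMap.pi fun n =>
    { toFun := fun r => f n * r
      map_add' := mul_add _
      map_smul' := fun c r => by simp only [hsmul, RingHom.id_apply]; ring }
  let M : (ℕ → F) →ₗ[F] ℕ → R :=
    { toFun := fun a n => f n * ρ (a n)
      map_add' := fun a b => by ext n; simp [mul_add]
      map_smul' := fun c a => by
        ext n; simp only [Pi.smul_apply, smul_eq_mul, map_mul, hsmul, RingHom.id_apply]; ring }
  have hM : Function.Injective M := by
    rw [injective_iff_map_eq_zero]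
    intro a ha
    ext n
    by_contra h
    have h0 : f n * ρ (a n) = 0 := congrFun ha n
    refine hf n ?_
    rw [← mul_one (f n), ← map_one ρ, ← mul_inv_cancel₀ (h : a n ≠ 0), map_mul, ← mul_assoc, h0,
      zero_mul]
  -- `M` embeds the kernel in the range of `L`, a quotient of `R`.
  have hker : Module.rank F (LinearMap.ker Ψ) ≤ Cardinal.aleph0 := by
    have h1 : (LinearMap.ker Ψ).map M ≤ LinearMap.range L := by
      rintro _ ⟨a, ha, rfl⟩
      obtain ⟨r, hr⟩ := hΨ a ha
      exact ⟨r, funext fun n => (hr n).symm⟩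
    calc Module.rank F (LinearMap.ker Ψ)
        = Module.rank F ((LinearMap.ker Ψ).map M) :=
          (Submodule.equivMapOfInjective M hM _).rank_eq
      _ ≤ Module.rank F (LinearMap.range L) := Submodule.rank_mono h1
      _ ≤ Module.rank F R := rank_range_le L
      _ ≤ Cardinal.aleph0 := hR
  have hrange : Module.rank F (LinearMap.range Ψ) ≤ Cardinal.aleph0 :=
    (Submodule.rank_le _).trans (Module.rank_lt_aleph0 F E).le
  refine (aleph0_lt_rank_nat_fun F).not_ge ?_
  rw [← LinearMap.rank_range_add_rank_ker Ψ]
  exact (add_le_add hrange hker).trans Cardinal.aleph0_add_aleph0.le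

/-! ### The augmentation ideal and `Ext¹(F, Fᵉ)` -/

section Diagonal

variable (k : Type u) [Field k] (F : Type v) [Field F] [Algebra k F]

/-- The multiplication map `F ⊗ Fᵒᵖ → F` as a homomorphism of left modules. -/
def augmentation : Env k F →ₗ[Env k F] diagonal k F :=
  LinearMap.toSpanSingleton (Env k F) (diagonal k F) (show F from 1)

/-- The kernel of the multiplication map `F ⊗ Fᵒᵖ → F`. -/
def augmentationIdeal : Ideal (Env k F) := LinearMap.ker (augmentation k F)

variable {k F}

lemma augmentation_tmul (a : F) (b : Fᵐᵒᵖ) :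
    augmentation k F (a ⊗ₜ b) = (show F from a * b.unop) := by
  let : Module (Env k F) F := TensorProduct.Algebra.module
  change ((a ⊗ₜ[k] b : Env k F) • (1 : F) : F) = _
  rw [TensorProduct.Algebra.smul_def]
  simp [mul_comm]

lemma augmentation_surjective : Function.Surjective (augmentation k F) := fun a =>
  ⟨(show F from a) ⊗ₜ 1, by rw [augmentation_tmul]; exact mul_one (show F from a)⟩

lemma tmul_sub_tmul_mem (a : F) :
    (a ⊗ₜ 1 - 1 ⊗ₜ MulOpposite.op a : Env k F) ∈ augmentationIdeal k F := by
  refine LinearMap.sub_mem_ker_iff.2 ?_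
  rw [augmentation_tmul, augmentation_tmul]
  exact mul_comm a 1

/-- Take a nonzero coordinate of `s` in its right factor. The action of `a ⊗ 1` scales it by `a`,
while `1 ⊗ a` keeps it in the finite span of the left factors of `s`; so that span is all of `F`. -/
lemma finite_of_tmul_mul_eq {s : Env k F} (hs : s ≠ 0)
    (h : ∀ a : F, (a ⊗ₜ 1) * s = (1 ⊗ₜ MulOpposite.op a) * s) : Module.Finite k F := by
  classical
  let b := Module.Basis.ofVectorSpace k Fᵐᵒᵖ
  let E := TensorProduct.equivFinsuppOfBasisRight (M := F) b
  obtain ⟨j, hj⟩ : ∃ j, E s j ≠ 0 := by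
    by_contra! h
    exact hs (E.map_eq_zero_iff.1 (Finsupp.ext h))
  let c : Env k F →ₗ[k] F := Finsupp.lapply j ∘ₗ E.toLinearMap
  have hc : ∀ x y, c (x ⊗ₜ y) = b.repr y j • x := fun x y => by
    simp [c, E]
  have hmul : ∀ (a : F) (t : Env k F), c ((a ⊗ₜ 1) * t) = a * c t := by
    intro a t
    induction t using TensorProduct.induction_on with
    | zero => simp
    | add x y hx hy => rw [mul_add, map_add, map_add, mul_add, hx, hy]
    | tmul x y => rw [Algebra.TensorProduct.tmul_mul_tmul, one_mul, hc, hc, mul_smul_comm]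
  obtain ⟨T, hT⟩ := TensorProduct.exists_finset s
  have hmem : ∀ a : F, c ((1 ⊗ₜ MulOpposite.op a) * s) ∈
      Submodule.span k (T.image Prod.fst : Set F) := by
    intro a
    rw [hT, Finset.mul_sum, map_sum]
    refine sum_mem fun i hi => ?_
    rw [Algebra.TensorProduct.tmul_mul_tmul, one_mul, hc]
    exact Submodule.smul_mem _ _ (Submodule.subset_span
      (Finset.mem_coe.2 (Finset.mem_image_of_mem _ hi)))
  refine ⟨⟨T.image Prod.fst, top_le_iff.1 fun z _ => ?_⟩⟩
  have := hmem (z / E s j)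
  rw [← h, hmul, show c s = E s j from rfl, div_mul_cancel₀ _ hj] at this
  exact this

lemma exists_mem_mul_ne (hF : ¬ Module.Finite k F) (e : Env k F) (he : e ∈ augmentationIdeal k F) :
    ∃ y ∈ augmentationIdeal k F, y * e ≠ y := by
  by_contra! h
  -- If `e` fixed the ideal, every `a ⊗ 1 - 1 ⊗ a` would annihilate `1 - e`, which is nonzero
  -- because it has augmentation `1`.
  refine hF (finite_of_tmul_mul_eq (s := 1 - e) ?_ fun a => ?_)
  · rw [sub_ne_zero]
    rintro rfl
    rw [augmentationIdeal, LinearMap.mem_ker, Algebra.TensorProduct.one_def,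
      augmentation_tmul] at he
    exact one_ne_zero (α := F) ((mul_one (1 : F)).symm.trans he)
  · rw [← sub_eq_zero, ← sub_mul, mul_sub, mul_one, h _ (tmul_sub_tmul_mem a), sub_self]

lemma not_isNoetherianRing_env [Algebra.IsSeparable k F] (hF : ¬ Module.Finite k F) :
    ¬ IsNoetherianRing (Env k F) := by
  intro h
  obtain ⟨e, he, hI⟩ := (isVonNeumannRegular_tensor k F Fᵐᵒᵖ).exists_idempotent_of_fg
    (IsNoetherian.noetherian (augmentationIdeal k F))
  obtain ⟨y, hy, hye⟩ := exists_mem_mul_ne hF e he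
  exact hye (hI y hy)

variable (k F) in
/-- The exact sequence `0 → J → F ⊗ Fᵒᵖ → F → 0`. -/
abbrev augmentationSequence : ShortComplex (ModuleCat.{v} (Env k F)) :=
  ShortComplex.mk (X₁ := ModuleCat.of (Env k F) (augmentationIdeal k F)) (X₂ := envSelf k F)
    (X₃ := diagonal k F)
    (ModuleCat.ofHom (augmentationIdeal k F).subtype)
    (ModuleCat.ofHom (Y := diagonal k F) (augmentation k F)) (by
      ext x
      exact x.2)

lemma augmentationSequence_shortExact : (augmentationSequence k F).ShortExact := by
  refine ModuleCat.shortComplex_shortExact _ ?_ ?_ ?_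
  · exact LinearMap.exact_subtype_ker_map (augmentation k F)
  · exact Subtype.val_injective
  · exact augmentation_surjective

variable {e : ℕ → Env k F} (he : IsExhausting (augmentationIdeal k F) e)

/-- The homomorphism from the augmentation ideal that multiplies the `n`-th component by
`1 ⊗ a n`. -/
def IsExhausting.sequenceHom (a : ℕ → F) :
    ModuleCat.of (Env k F) (augmentationIdeal k F) ⟶ envSelf k F :=
  ModuleCat.ofHom
    (Finsupp.linearCombination (Env k F) (fun n => (1 ⊗ₜ MulOpposite.op (a n) : Env k F)) ∘ₗ
      he.components)

lemma IsExhausting.sequenceHom_add (a b : ℕ → F) :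
    he.sequenceHom (a + b) = he.sequenceHom a + he.sequenceHom b := by
  ext x
  simp [IsExhausting.sequenceHom, Finsupp.linearCombination_apply, TensorProduct.tmul_add, mul_add,
    Finsupp.sum_add]

/-- The switch turns the left action of `F` on `Ext` into multiplication by `1 ⊗ c`; scaling by `1 ⊗
a n` is what makes `sequenceExt` linear. -/
lemma IsExhausting.sequenceHom_smul (c : F) (a : ℕ → F) :
    he.sequenceHom (c • a) = he.sequenceHom a ≫ rightMul k F (switch k F (c ⊗ₜ 1)) := by
  ext x
  change Finsupp.linearCombination _ _ (he.components x) =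
    Finsupp.linearCombination _ _ (he.components x) * ((1 : F) ⊗ₜ[k] MulOpposite.op c)
  rw [Finsupp.linearCombination_apply, Finsupp.linearCombination_apply, Finsupp.sum, Finsupp.sum,
    Finset.sum_mul]
  refine Finset.sum_congr rfl fun n _ => ?_
  rw [smul_eq_mul, smul_eq_mul, mul_assoc, Algebra.TensorProduct.tmul_mul_tmul, one_mul,
    ← MulOpposite.op_mul]
  rfl

/-- The map from sequences in `F` to `Ext¹(F, F ⊗ Fᵒᵖ)`. -/
def IsExhausting.sequenceExt : (ℕ → F) →ₗ[F] extLeftModule k F 1 where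
  toFun a := augmentationSequence_shortExact.extClass.comp
    (Abelian.Ext.mk₀ (he.sequenceHom a)) (add_zero 1)
  map_add' a b := by
    rw [he.sequenceHom_add, Abelian.Ext.mk₀_add, Abelian.Ext.comp_add]
    rfl
  map_smul' c a := by
    rw [he.sequenceHom_smul, ← Abelian.Ext.mk₀_comp_mk₀,
      ← Abelian.Ext.comp_assoc_of_second_deg_zero]
    rfl

/-- By the long exact sequence the homomorphism extends to `Fᵉ`, where it is right multiplication by
the image `r` of `1`. Evaluation at `e (n + 1) - e n` isolates the term `a n`. -/
lemma IsExhausting.exists_of_sequenceExt_eq_zero {a : ℕ → F} (ha : he.sequenceExt a = 0) :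
    ∃ r : Env k F, ∀ n, (e (n + 1) - e n) * (1 ⊗ₜ MulOpposite.op (a n)) =
      (e (n + 1) - e n) * r := by
  obtain ⟨x, hx⟩ := Abelian.Ext.contravariant_sequence_exact₁ augmentationSequence_shortExact _
    (Abelian.Ext.mk₀ (he.sequenceHom a)) (add_zero 1) ha
  obtain ⟨g, rfl⟩ := Abelian.Ext.homEquiv₀.symm.surjective x
  have hg : (augmentationSequence k F).f ≫ g = he.sequenceHom a :=
    Abelian.Ext.homEquiv₀.symm.injective (by simpa using hx)
  refine ⟨g.hom (1 : Env k F), fun n => ?_⟩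
  let y : augmentationIdeal k F := ⟨e (n + 1), he.mem _⟩ - ⟨e n, he.mem _⟩
  have h := congrArg (fun φ => φ.hom y) hg
  have h1 : (he.sequenceHom a).hom y = (e (n + 1) - e n) * (1 ⊗ₜ MulOpposite.op (a n)) := by
    change Finsupp.linearCombination _ _ (he.components y) = _
    rw [show he.components y = _ from he.components_sub n, Finsupp.linearCombination_single]
    rfl
  rw [← h1, ← h]
  change g.hom (e (n + 1) - e n : Env k F) = _
  rw [← smul_eq_mul, ← map_smul, smul_eq_mul, mul_one]

lemma not_finite_extLeftModule_one [Algebra.IsSeparable k F]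
    (hdim : Module.rank k F = Cardinal.aleph0) : ¬ Module.Finite F (extLeftModule k F 1) := by
  have hF : ¬ Module.Finite k F := fun h => (Module.rank_lt_aleph0 k F).ne hdim
  let b := Module.Basis.ofVectorSpace k F
  have : Countable (Module.Basis.ofVectorSpaceIndex k F) := by
    rw [← Cardinal.mk_le_aleph0_iff, b.mk_eq_rank'', hdim]
  obtain ⟨x, hx⟩ := exists_span_range_eq (U := Fᵐᵒᵖ) b (augmentationIdeal k F)
  obtain ⟨e, he, hne⟩ := (isVonNeumannRegular_tensor k F Fᵐᵒᵖ).exists_isExhausting_strict x hx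
    (exists_mem_mul_ne hF)
  let ρ : F →+* Env k F := (Algebra.TensorProduct.includeRight : Fᵐᵒᵖ →ₐ[k] Env k F).toRingHom.comp
    (RingEquiv.toOpposite F).toRingHom
  refine not_finite_of_linearMap ρ (S := Set.range fun i => b i ⊗ₜ 1) (Set.countable_range _) ?_
    (f := fun n => e (n + 1) - e n) (fun n => sub_ne_zero.2 (hne n).symm) he.sequenceExt
    fun a ha => he.exists_of_sequenceExt_eq_zero ha
  intro p hp hρ
  rw [eq_top_iff]
  rintro x -
  induction x using TensorProduct.induction_on with
  | zero => exact zero_mem _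
  | add x y hx hy => exact add_mem hx hy
  | tmul f y =>
    have h1 : f ⊗ₜ[k] y = ∑ i ∈ (b.repr f).support,
        ρ (algebraMap k F (b.repr f i) * y.unop) * (b i ⊗ₜ 1) := by
      conv_lhs => rw [← b.linearCombination_repr f, Finsupp.linearCombination_apply, Finsupp.sum,
        TensorProduct.sum_tmul]
      refine Finset.sum_congr rfl fun i _ => ?_
      change _ = ((1 : F) ⊗ₜ[k] MulOpposite.op (algebraMap k F (b.repr f i) * y.unop)) * _
      rw [Algebra.TensorProduct.tmul_mul_tmul, one_mul, mul_one, TensorProduct.smul_tmul,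
        Algebra.smul_def, mul_comm]
      rfl
    rw [h1]
    exact sum_mem fun i _ => hρ _ _ (hp ⟨i, rfl⟩)

end Diagonal

/-! ### Values of the transcendence degrees, and rigidity -/

section Degrees

variable {k : Type u} [Field k] {F : Type v} [Field F] [Algebra k F]

lemma htr_eq_zero_of_finite (G : Type v) [Field G] [Algebra k G] [FiniteDimensional k G]
    [Algebra.IsSeparable k G] : htr k G = 0 :=
  have := isNoetherianRing_tensor k G Gᵐᵒᵖ
  (isVonNeumannRegular_tensor k G Gᵐᵒᵖ).injdim_eq_zero

lemma nontrivial_ext_one [Algebra.IsSeparable k F]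
    (hdim : Module.rank k F = Cardinal.aleph0) :
    Nontrivial (Abelian.Ext (diagonal k F) (envSelf k F) 1) := by
  by_contra h
  rw [not_nontrivial_iff_subsingleton] at h
  have : Subsingleton (extLeftModule k F 1) := h
  exact not_finite_extLeftModule_one hdim inferInstance

lemma one_le_projectiveDimension_diagonal [Algebra.IsSeparable k F]
    (hdim : Module.rank k F = Cardinal.aleph0) : 1 ≤ projectiveDimension (diagonal k F) := by
  refine (projectiveDimension_ge_iff (diagonal k F) 1).2 fun h => ?_
  have := nontrivial_ext_one hdim
  exact not_subsingleton _ (h.subsingleton _ 1 1 le_rfl (envSelf k F))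

lemma gldim_env_eq_one [Algebra.IsSeparable k F]
    (hdim : Module.rank k F = Cardinal.aleph0) : gldim (F ⊗[k] Fᵐᵒᵖ) = 1 :=
  le_antisymm (gldim_le_one_of_projective (projective_ideal_tensor hdim))
    ((one_le_projectiveDimension_diagonal hdim).trans
      (le_iSup (fun M : ModuleCat.{v} (Env k F) => projectiveDimension M) (diagonal k F)))

lemma htr_eq_one [Algebra.IsSeparable k F] (hdim : Module.rank k F = Cardinal.aleph0) :
    htr k F = 1 := by
  refine le_antisymm (injdim_le_one_of_projective (projective_ideal_tensor hdim)) ?_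
  refine (injectiveDimension_ge_iff (envSelf k F) 1).2 fun h => ?_
  have := nontrivial_ext_one hdim
  exact not_subsingleton _ (h.subsingleton _ 1 1 le_rfl (diagonal k F))

lemma fhtr_eq_one [Algebra.IsSeparable k F] (hdim : Module.rank k F = Cardinal.aleph0) :
    fhtr k F = 1 := by
  refine le_antisymm (iSup₂_le fun i hi => ?_)
    (le_iSup₂_of_le 1 (nontrivial_ext_one hdim) le_rfl)
  by_contra! h
  have h2 : 2 ≤ i := by
    have : (1 : ℕ) < i := by exact_mod_cast h
    exact this
  have := hasProjectiveDimensionLT_two_of_projective (R := Env k F) (projective_ideal_tensor hdim)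
    (diagonal k F)
  exact not_subsingleton _
    (HasProjectiveDimensionLT.subsingleton (diagonal k F) 2 i h2 (envSelf k F))

lemma shtr_eq_one [Algebra.IsSeparable k F] (hdim : Module.rank k F = Cardinal.aleph0) :
    shtr.{u, v, max u v w} k F = 1 := by
  refine le_antisymm (iSup_le fun U => iSup₂_le fun _ _ =>
    injdim_le_one_of_projective (projective_ideal_tensor hdim)) ?_
  -- The supremum is attained at `U = F`, lifted to the larger universe.
  let ε : F ⊗[k] ULift.{max u v w} F ≃ₐ[k] Env k F := Algebra.TensorProduct.congr AlgEquiv.refl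
    (ULift.algEquiv.trans (AlgEquiv.toOpposite k F))
  rw [← htr_eq_one hdim, htr, ← injdim_eq_of_ringEquiv ε.toRingEquiv]
  exact le_iSup_of_le (ULift.{max u v w} F) (le_iSup₂_of_le inferInstance inferInstance le_rfl)

lemma thtr_eq_zero [Algebra.IsSeparable k F] : thtr.{u, v, max u v w} k F = 0 := by
  refine le_antisymm (iSup_le fun U => iSup₂_le fun _ _ => iSup_le fun h => ?_) ?_
  · have := h.1
    exact (isVonNeumannRegular_tensor k F U).injdim_eq_zero.le
  -- `U = k` is admissible, so the supremum is not `-∞`.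
  let ε : F ⊗[k] ULift.{max u v w} k ≃ₐ[k] F := (Algebra.TensorProduct.congr AlgEquiv.refl
    ULift.algEquiv).trans (Algebra.TensorProduct.rid k k F)
  have h : IsNoetherianBothSides (F ⊗[k] ULift.{max u v w} k) :=
    ⟨isNoetherianRing_of_ringEquiv F ε.symm.toRingEquiv,
      isNoetherianRing_of_ringEquiv F
        ((RingEquiv.toOpposite F).trans (RingEquiv.op ε.symm.toRingEquiv))⟩
  exact le_iSup_of_le (ULift.{max u v w} k) (le_iSup₂_of_le inferInstance inferInstance
    (le_iSup_of_le h zero_le_injdim))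

lemma not_isRigid [Algebra.IsSeparable k F] (hdim : Module.rank k F = Cardinal.aleph0) :
    ¬ IsRigid k F := by
  rintro ⟨n, σ, ⟨ε⟩, h⟩
  obtain rfl : n = 1 := by
    by_contra hn
    have := nontrivial_ext_one hdim
    exact not_subsingleton _ (h 1 (Ne.symm hn))
  let ε' := ((ModuleCat.restrictScalars
    (Algebra.TensorProduct.includeLeft : F →ₐ[k] Env k F).toRingHom).mapIso ε).toLinearEquiv
  -- The twist affects only the right action, so on the left `F^σ` is `F` itself.
  refine not_finite_extLeftModule_one hdim (Module.Finite.of_surjective (M := F)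
    (ε'.symm.toLinearMap ∘ₗ
      ({ toFun := fun x => x, map_add' := fun _ _ => rfl, map_smul' := fun c x => ?_ } :
        F →ₗ[F] (ModuleCat.restrictScalars (Algebra.TensorProduct.includeLeft :
          F →ₐ[k] Env k F).toRingHom).obj (twisted k σ))) ?_)
  · change _ = ((Algebra.TensorProduct.map (AlgHom.id k F) (AlgHom.op σ.toAlgHom)
      (c ⊗ₜ[k] (1 : Fᵐᵒᵖ)) : Env k F) • (show diagonal k F from x) : diagonal k F)
    rw [Algebra.TensorProduct.map_tmul, map_one]
    let : Module (Env k F) F := TensorProduct.Algebra.module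
    change _ = ((c ⊗ₜ[k] (1 : Fᵐᵒᵖ) : Env k F) • x : F)
    rw [TensorProduct.Algebra.smul_def]
    simp
  · exact ε'.symm.surjective.comp Function.surjective_id

end Degrees

end HomTr

end

theorem proposition7p1 (k : Type u) (F : Type v) [Field k] [Field F] [Algebra k F]
    (hsep : Algebra.IsSeparable k F) (hdim : Module.rank k F = Cardinal.aleph0) :
    (HomTr.IsSmooth k F ∧ HomTr.IsHomologicallyUniform.{u, v, max u v w} k F ∧
      HomTr.htr k F = 1 ∧ HomTr.gldim (F ⊗[k] Fᵐᵒᵖ) = 1) ∧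
    (¬ HomTr.IsDoublyNoetherian k F ∧
      (∀ G : IntermediateField k F, FiniteDimensional k G → HomTr.htr k G = 0) ∧
      (⨆ (G : IntermediateField k F) (_ : FiniteDimensional k G), HomTr.htr k G) = 0) ∧
    (HomTr.thtr.{u, v, max u v w} k F = 0 ∧ Algebra.trdeg k F = 0) ∧
    (¬ HomTr.IsRigid k F ∧ ¬ Module.Finite F (HomTr.extLeftModule k F 1)) := by

  have hF : ¬ Module.Finite k F := fun h => (Module.rank_lt_aleph0 k F).ne hdim
  have hG : ∀ G : IntermediateField k F, FiniteDimensional k G → HomTr.htr k G = 0 := fun G _ =>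
    HomTr.htr_eq_zero_of_finite G
  refine ⟨⟨?_, ?_, HomTr.htr_eq_one hdim, HomTr.gldim_env_eq_one hdim⟩,
    ⟨fun h => HomTr.not_isNoetherianRing_env hF h.1, hG, ?_⟩,
    ⟨HomTr.thtr_eq_zero, trdeg_eq_zero⟩,
    HomTr.not_isRigid hdim, HomTr.not_finite_extLeftModule_one hdim⟩
  · exact (HomTr.projectiveDimension_le_one_of_projective
      (HomTr.projective_ideal_tensor hdim) _).trans_lt (by decide)
  · rw [HomTr.IsHomologicallyUniform, HomTr.htr_eq_one hdim, HomTr.fhtr_eq_one hdim,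
      HomTr.shtr_eq_one hdim]
    exact ⟨rfl, rfl, by decide⟩
  · refine le_antisymm (iSup₂_le fun G hG' => (hG G hG').le) ?_
    -- The subfield `k` shows that the supremum is not `-∞`.
    exact le_iSup₂_of_le ⊥ inferInstance (hG ⊥ inferInstance).ge
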